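/- Let $A\in\mathbb{Q}^{m\times n}$, let $C=\{x\in\mathbb{R}^n : Ax\le \mathbf 0\}$, and let $C^*=\{x\in\mathbb{R}^n : z^\top x\le 0 \text{ for all } z\in C\}$ be its polar cone. Then the following statements are equivalent: 1. $C$ is box-TDI; 2. $C$ is box-integer; 3. $C^*$ is box-TDI; 4. $C^*$ is box-integer. Here a polyhedron is a set $P=\{x\in\mathbb{R}^n : Bx\le b\}$ with $B$ and $b$ rational, and a face of $P$ is a nonempty set obtained from $P$ by imposing equality in some of the inequalities of $Bx\le b$. The polyhedron $P$ is *integer* if each of its faces contains a point of $\mathbb{Z}^n$, and *box-integer* if $P\cap\{x:\ell\le x\le u\}$ is integer for all $\ell,u\in\mathbb{Z}^n$. A rational system $Bx\le b$ is *totally dual integral* (TDI) if, for every integer vector $w$ for which the optimum of $\min\{b^\top y : B^\top y=w,\ y\ge\mathbf 0\}$ is finite, this minimum is attained by an integer vector $y$. The system $Bx\le b$ is *box-TDI* if the system $Bx\le b,\ \ell\le x\le u$ is TDI for all $\ell,u\in\mathbb{Q}^n$, and a polyhedron is *box-TDI* if it can be described by some box-TDI system. -/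

import Mathlib

open scoped Matrix

namespace BoxTDI

/-- The real matrix underlying a rational matrix. -/
noncomputable def realMat {ι κ : Type*} (A : Matrix ι κ ℚ) : Matrix ι κ ℝ :=
  A.map fun q => (q : ℝ)

/-- The real vector underlying a rational vector. -/
noncomputable def ratVec {ι : Type*} (b : ι → ℚ) : ι → ℝ := fun i => (b i : ℝ)

/-- The real vector underlying an integer vector. -/
noncomputable def intVec {ι : Type*} (z : ι → ℤ) : ι → ℝ := fun i => (z i : ℝ)

/-- The solution set `{x ∈ ℝⁿ : A x ≤ b}` of a rational linear system. -/
def polyhedron {n : ℕ} {ι : Type*} (A : Matrix ι (Fin n) ℚ) (b : ι → ℚ) : Set (Fin n → ℝ) :=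
  {x | realMat A *ᵥ x ≤ ratVec b}

/-- `P` is a (rational) polyhedron of `ℝⁿ`. -/
def IsPolyhedron {n : ℕ} (P : Set (Fin n → ℝ)) : Prop :=
  ∃ (m : ℕ) (A : Matrix (Fin m) (Fin n) ℚ) (b : Fin m → ℚ), P = polyhedron A b

/-- `F` is a face of the polyhedron `P`: a nonempty set obtained by imposing equality on some
inequalities in a description `A x ≤ b` of `P`. -/
def IsFace {n : ℕ} (P F : Set (Fin n → ℝ)) : Prop :=
  F.Nonempty ∧
    ∃ (m : ℕ) (A : Matrix (Fin m) (Fin n) ℚ) (b : Fin m → ℚ) (I : Set (Fin m)),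
      P = polyhedron A b ∧
        F = {x | x ∈ P ∧ ∀ i ∈ I, (realMat A *ᵥ x) i = ratVec b i}

/-- An integer polyhedron: each of its faces contains an integer point. -/
def IsIntegerPolyhedron {n : ℕ} (P : Set (Fin n → ℝ)) : Prop :=
  IsPolyhedron P ∧ ∀ F : Set (Fin n → ℝ), IsFace P F → ∃ z : Fin n → ℤ, intVec z ∈ F

/-- A box-integer polyhedron: its intersection with each integer box `{x : ℓ ≤ x ≤ u}` is an
integer polyhedron. -/
def IsBoxInteger {n : ℕ} (P : Set (Fin n → ℝ)) : Prop :=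
  IsPolyhedron P ∧
    ∀ l u : Fin n → ℤ, IsIntegerPolyhedron (P ∩ {x | intVec l ≤ x ∧ x ≤ intVec u})

/-- The feasible region `{y : Aᵀ y = w, y ≥ 0}` of the dual of `max {wᵀ x : A x ≤ b}`. -/
def dualFeasible {n : ℕ} {ι : Type*} [Fintype ι] (A : Matrix ι (Fin n) ℚ) (w : Fin n → ℤ) :
    Set (ι → ℝ) :=
  {y | (realMat A)ᵀ *ᵥ y = intVec w ∧ 0 ≤ y}

/-- The system `A x ≤ b` is totally dual integral: for each integer vector `w` for which the
optimum `min {bᵀ y : Aᵀ y = w, y ≥ 0}` is finite, this minimum is attained by an integer vector. -/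
def IsTDI {n : ℕ} {ι : Type*} [Fintype ι] (A : Matrix ι (Fin n) ℚ) (b : ι → ℚ) : Prop :=
  ∀ w : Fin n → ℤ, (dualFeasible A w).Nonempty →
    BddBelow ((fun y => ratVec b ⬝ᵥ y) '' dualFeasible A w) →
      ∃ z : ι → ℤ, intVec z ∈ dualFeasible A w ∧
        ∀ y ∈ dualFeasible A w, ratVec b ⬝ᵥ intVec z ≤ ratVec b ⬝ᵥ y

/-- Constraint matrix of the system `A x ≤ b, x ≤ u, -x ≤ -ℓ`. -/
def boxMatrix {n : ℕ} {ι : Type*} (A : Matrix ι (Fin n) ℚ) :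
    Matrix (ι ⊕ (Fin n ⊕ Fin n)) (Fin n) ℚ :=
  Matrix.fromRows A (Matrix.fromRows 1 (-1))

/-- Right-hand side of the system `A x ≤ b, x ≤ u, -x ≤ -ℓ`. -/
def boxRhs {n : ℕ} {ι : Type*} (b : ι → ℚ) (l u : Fin n → ℚ) : ι ⊕ (Fin n ⊕ Fin n) → ℚ :=
  Sum.elim b (Sum.elim u (-l))

/-- The system `A x ≤ b` is box-TDI: `A x ≤ b, ℓ ≤ x ≤ u` is TDI for all rational `ℓ`, `u`. -/
def IsBoxTDISystem {n : ℕ} {ι : Type*} [Fintype ι] (A : Matrix ι (Fin n) ℚ) (b : ι → ℚ) : Prop :=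
  ∀ l u : Fin n → ℚ, IsTDI (boxMatrix A) (boxRhs b l u)

/-- A box-TDI polyhedron: one that can be described by a box-TDI system. -/
def IsBoxTDI {n : ℕ} (P : Set (Fin n → ℝ)) : Prop :=
  ∃ (m : ℕ) (A : Matrix (Fin m) (Fin n) ℚ) (b : Fin m → ℚ),
    P = polyhedron A b ∧ IsBoxTDISystem A b

/-- The polar cone `C* = {x : zᵀ x ≤ 0 for all z ∈ C}`. -/
def polar {n : ℕ} (C : Set (Fin n → ℝ)) : Set (Fin n → ℝ) :=
  {x | ∀ z ∈ C, z ⬝ᵥ x ≤ 0}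

end BoxTDI

/-! Two implications, each valid for any rational polyhedral cone, close the cycle: a box-TDI cone
is box-integer (`IsBoxTDI.isBoxInteger`), and the polar of a box-integer cone is box-TDI
(`isBoxTDI_of_isBoxInteger_ratCone`). By Weyl, Minkowski and Farkas, `C` and its polar are each both
finitely generated and given by inequalities, so both implications apply to both cones.

For the first, an integer dual optimum on an integer box shows that the maximum of `w ⬝ᵥ x` is an
integer: on a cone only the box multipliers matter, whatever the right-hand side `b`. A compact
polyhedron with integer maxima in all integer directions is integer (Edmonds–Giles).

For the second, describe the polar by a Hilbert basis of the box-integer cone `D`. After elimination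
of the box multipliers, the dual minimises over `x ∈ D` a separable convex function with integer
breakpoints. It is affine on unit integer boxes, so box-integrality of `D` rounds `x` to an integer
point without raising the cost, and the Hilbert basis turns that point into integer multipliers. -/

namespace BoxTDI

open scoped NNReal
open Finset

/-! ### Weyl, Minkowski and Farkas for rational cones -/

section Cones

variable {κ : Type*}

/-- The convex cone generated by finitely many rational vectors. -/
noncomputable def ratCone (T : Finset (κ → ℚ)) : Submodule ℝ≥0 (κ → ℝ) :=
  Submodule.span ℝ≥0 (ratVec '' (T : Set (κ → ℚ)))

theorem ratVec_mem_ratCone {T : Finset (κ → ℚ)} {a : κ → ℚ} (ha : a ∈ T) :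
    ratVec a ∈ ratCone T :=
  Submodule.subset_span ⟨a, ha, rfl⟩

/-- One step of Fourier–Motzkin elimination in one nonnegative unknown. -/
theorem exists_nonneg_mul_le_iff {α : Type*} (S : Finset α) (p q : α → ℝ) :
    (∃ t : ℝ, 0 ≤ t ∧ ∀ a ∈ S, p a ≤ t * q a) ↔
      (∀ a ∈ S, q a ≤ 0 → p a ≤ 0) ∧
        ∀ a ∈ S, ∀ b ∈ S, 0 < q a → q b < 0 → q a * p b - q b * p a ≤ 0 := by
  classical
  constructor
  · rintro ⟨t, ht, h⟩
    refine ⟨fun a ha hq => (h a ha).trans (mul_nonpos_of_nonneg_of_nonpos ht hq), ?_⟩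
    intro a ha b hb hqa hqb
    nlinarith [mul_le_mul_of_nonneg_left (h b hb) hqa.le,
      mul_le_mul_of_nonneg_left (h a ha) (neg_nonneg.2 hqb.le)]
  · rintro ⟨h1, h2⟩
    -- The lower bounds imposed on `t`; their maximum is the witness, and 0 encodes `0 ≤ t`.
    let L : Finset ℝ := insert 0 ((S.filter fun a => 0 < q a).image fun a => p a / q a)
    have hL : L.Nonempty := ⟨0, mem_insert_self _ _⟩
    refine ⟨L.max' hL, L.le_max' 0 (mem_insert_self _ _), fun a ha => ?_⟩
    rcases lt_or_ge 0 (q a) with hq | hq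
    · have : p a / q a ≤ L.max' hL :=
        L.le_max' _ (mem_insert_of_mem (mem_image.2 ⟨a, mem_filter.2 ⟨ha, hq⟩, rfl⟩))
      exact (div_le_iff₀ hq).1 this
    · rcases hq.eq_or_lt with hq0 | hq0
      · rw [hq0, mul_zero]; exact h1 a ha hq
      · have key : ∀ c ∈ L, p a ≤ c * q a := by
          intro c hc
          rcases mem_insert.1 hc with rfl | hc
          · rw [zero_mul]; exact h1 a ha hq
          · obtain ⟨b, hb, rfl⟩ := mem_image.1 hc
            obtain ⟨hb, hqb⟩ := mem_filter.1 hb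
            have := h2 b hb a ha hqb hq0
            rw [div_mul_eq_mul_div, le_div_iff₀ hqb]
            linarith
        exact key _ (L.max'_mem hL)

variable [Fintype κ]

theorem ratVec_dotProduct_ratVec (a b : κ → ℚ) : ratVec a ⬝ᵥ ratVec b = ((a ⬝ᵥ b : ℚ) : ℝ) := by
  simp [ratVec, dotProduct]

theorem ratVec_smul_sub_smul_dotProduct (p q : ℚ) (a b : κ → ℚ) (x : κ → ℝ) :
    ratVec (p • a - q • b) ⬝ᵥ x = p * (ratVec a ⬝ᵥ x) - q * (ratVec b ⬝ᵥ x) := by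
  simp [ratVec, dotProduct, Finset.mul_sum, ← Finset.sum_sub_distrib, sub_mul, mul_assoc]

/-- Weyl's theorem: a cone generated by finitely many rational vectors is the solution set of a
finite homogeneous rational system. -/
theorem exists_mem_ratCone_iff (T : Finset (κ → ℚ)) :
    ∃ S : Finset (κ → ℚ), ∀ x : κ → ℝ, x ∈ ratCone T ↔ ∀ a ∈ S, ratVec a ⬝ᵥ x ≤ 0 := by
  classical
  induction T using Finset.induction_on with
  | empty =>
    refine ⟨univ.image (fun i => Pi.single i 1) ∪ univ.image (fun i => Pi.single i (-1)), ?_⟩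
    have h1 : ∀ (i : κ) (c : ℚ) (x : κ → ℝ), ratVec (Pi.single i c) ⬝ᵥ x = c * x i := by
      intro i c x
      have : ratVec (Pi.single i c) = Pi.single i (c : ℝ) := by
        ext j; by_cases h : j = i
        · subst h; simp [ratVec]
        · simp [ratVec, h]
      rw [this, single_dotProduct]
    intro x
    simp only [ratCone, coe_empty, Set.image_empty, Submodule.span_empty, Submodule.mem_bot]
    constructor
    · rintro rfl a _; simp
    · intro h
      ext i
      have ha := h (Pi.single i 1) (mem_union_left _ (mem_image_of_mem _ (mem_univ i)))
      have hb := h (Pi.single i (-1)) (mem_union_right _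
        (mem_image_of_mem (fun i : κ => (Pi.single i (-1) : κ → ℚ)) (mem_univ i)))
      rw [h1] at ha hb
      push_cast at ha hb
      simp only [Pi.zero_apply]
      linarith
  | insert g T _ ih =>
    obtain ⟨S, hS⟩ := ih
    -- Membership of `x` means `x - t • g` lies in the old cone for some `t ≥ 0`. Eliminating `t`
    -- keeps the `a` with `a ⬝ᵥ g ≤ 0` and combines pairs of opposite sign.
    refine ⟨S.filter (fun a => a ⬝ᵥ g ≤ 0) ∪
      ((S ×ˢ S).filter fun c => 0 < c.1 ⬝ᵥ g ∧ c.2 ⬝ᵥ g < 0).image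
        (fun c => (c.1 ⬝ᵥ g) • c.2 - (c.2 ⬝ᵥ g) • c.1), fun x => ?_⟩
    have hmem : x ∈ ratCone (insert g T) ↔
        ∃ t : ℝ, 0 ≤ t ∧ ∀ a ∈ S, ratVec a ⬝ᵥ x ≤ t * (ratVec a ⬝ᵥ ratVec g) := by
      have : ∀ t : ℝ, x - t • ratVec g ∈ ratCone T ↔
          ∀ a ∈ S, ratVec a ⬝ᵥ x ≤ t * (ratVec a ⬝ᵥ ratVec g) := by
        intro t
        rw [hS]
        simp [dotProduct_sub, dotProduct_smul]
      simp only [← this]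
      rw [ratCone, coe_insert, Set.image_insert_eq, Submodule.mem_span_insert]
      constructor
      · rintro ⟨c, z, hz, rfl⟩
        exact ⟨c, c.2, by rwa [NNReal.smul_def, add_sub_cancel_left]⟩
      · rintro ⟨t, ht, h⟩
        exact ⟨t.toNNReal, _, h, by rw [NNReal.smul_def, Real.coe_toNNReal t ht]; simp⟩
    rw [hmem, exists_nonneg_mul_le_iff]
    simp only [ratVec_dotProduct_ratVec]
    constructor
    · rintro ⟨h1, h2⟩ a ha
      rcases mem_union.1 ha with ha | ha
      · obtain ⟨ha, hq⟩ := mem_filter.1 ha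
        exact h1 a ha (by exact_mod_cast hq)
      · obtain ⟨c, hc, rfl⟩ := mem_image.1 ha
        obtain ⟨hc, hc1, hc2⟩ := mem_filter.1 hc
        obtain ⟨hcS, hcS'⟩ := mem_product.1 hc
        rw [ratVec_smul_sub_smul_dotProduct]
        exact h2 _ hcS _ hcS' (by exact_mod_cast hc1) (by exact_mod_cast hc2)
    · intro h
      refine ⟨fun a ha hq => h a (mem_union_left _ (mem_filter.2 ⟨ha, by exact_mod_cast hq⟩)), ?_⟩
      intro a ha b hb hqa hqb
      have := h _ (mem_union_right _ (mem_image.2 ⟨(a, b), mem_filter.2 ⟨mem_product.2 ⟨ha, hb⟩,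
        by exact_mod_cast hqa, by exact_mod_cast hqb⟩, rfl⟩))
      rwa [ratVec_smul_sub_smul_dotProduct] at this

theorem dotProduct_nonpos_of_mem_ratCone {T : Finset (κ → ℚ)} {x z : κ → ℝ} (hx : x ∈ ratCone T)
    (hz : ∀ a ∈ T, ratVec a ⬝ᵥ z ≤ 0) : z ⬝ᵥ x ≤ 0 := by
  induction hx using Submodule.span_induction with
  | mem x h =>
    obtain ⟨a, ha, rfl⟩ := h
    rw [dotProduct_comm]; exact hz a ha
  | zero => simp
  | add x y _ _ hx hy => rw [dotProduct_add]; linarith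
  | smul c x _ hx =>
    rw [NNReal.smul_def, dotProduct_smul, smul_eq_mul]
    exact mul_nonpos_of_nonneg_of_nonpos c.2 hx

/-- Farkas' lemma for cones generated by rational vectors, with a rational certificate. -/
theorem exists_rat_of_notMem_ratCone {T : Finset (κ → ℚ)} {x : κ → ℝ} (hx : x ∉ ratCone T) :
    ∃ z : κ → ℚ, (∀ a ∈ T, ratVec a ⬝ᵥ ratVec z ≤ 0) ∧ 0 < ratVec z ⬝ᵥ x := by
  obtain ⟨S, hS⟩ := exists_mem_ratCone_iff T
  rw [hS] at hx
  push Not at hx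
  obtain ⟨z, hz, hzx⟩ := hx
  refine ⟨z, fun a ha => ?_, hzx⟩
  rw [dotProduct_comm]
  exact (hS _).1 (ratVec_mem_ratCone ha) z hz

theorem mem_ratCone_iff_forall {T : Finset (κ → ℚ)} {x : κ → ℝ} :
    x ∈ ratCone T ↔ ∀ z : κ → ℝ, (∀ a ∈ T, ratVec a ⬝ᵥ z ≤ 0) → z ⬝ᵥ x ≤ 0 := by
  refine ⟨fun hx z hz => dotProduct_nonpos_of_mem_ratCone hx hz, fun h => ?_⟩
  by_contra hx
  obtain ⟨z, hz, hzx⟩ := exists_rat_of_notMem_ratCone hx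
  exact (h _ hz).not_gt hzx

/-- Minkowski's theorem: the solution set of a finite homogeneous rational system is generated by
finitely many rational vectors. -/
theorem exists_ratCone_eq (T : Finset (κ → ℚ)) :
    ∃ G : Finset (κ → ℚ), ∀ x : κ → ℝ, x ∈ ratCone G ↔ ∀ a ∈ T, ratVec a ⬝ᵥ x ≤ 0 := by
  -- The normals of the cone of `T` generate its polar, by Farkas.
  obtain ⟨G, hG⟩ := exists_mem_ratCone_iff T
  refine ⟨G, fun x => ?_⟩
  rw [mem_ratCone_iff_forall]
  simp only [← hG]
  constructor
  · intro h a ha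
    exact h _ (ratVec_mem_ratCone ha)
  · intro h z hz
    rw [dotProduct_comm]
    exact dotProduct_nonpos_of_mem_ratCone hz h

end Cones

/-! ### Linear programming duality -/

section Duality

variable {ι κ : Type*} [Fintype ι] [Fintype κ]

theorem realMat_mulVec_apply {α β : Type*} [Fintype β] (A : Matrix α β ℚ) (x : β → ℝ) (i : α) :
    (realMat A *ᵥ x) i = ratVec (A i) ⬝ᵥ x := rfl

/-- Affine Farkas lemma: a rational inequality that is valid on the nonempty solution set of a
finite rational system is a nonnegative combination of the system. -/
theorem exists_nonneg_combination (M : Matrix ι κ ℚ) (d : ι → ℚ) (c : κ → ℚ) (ν : ℝ)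
    (hne : ∃ x : κ → ℝ, realMat M *ᵥ x ≤ ratVec d)
    (h : ∀ x : κ → ℝ, realMat M *ᵥ x ≤ ratVec d → ratVec c ⬝ᵥ x ≤ ν) :
    ∃ y : ι → ℝ, 0 ≤ y ∧ (realMat M)ᵀ *ᵥ y = ratVec c ∧ ratVec d ⬝ᵥ y ≤ ν := by
  classical
  -- Homogenisation: coordinate `none` carries right-hand sides, and the extra generator `(1, 0)`
  -- allows slack in `ν`.
  let f : Option ι → Option κ → ℚ := fun i => i.elim (fun j => j.elim 1 0)
    fun i j => j.elim (d i) (M i)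
  let v : Option κ → ℝ := fun j => j.elim ν (ratVec c)
  have hf : ∀ (i : Option ι) (z : Option κ → ℝ), ratVec (f i) ⬝ᵥ z =
      i.elim (z none) fun i => d i * z none + ratVec (M i) ⬝ᵥ fun j => z (some j) := by
    intro i z
    cases i <;> simp [dotProduct, Fintype.sum_option, f, ratVec]
  have hv : v ∈ ratCone (univ.image f) := by
    rw [mem_ratCone_iff_forall]
    intro z hz
    have h0 : z none ≤ 0 := by
      simpa [hf] using hz (f none) (mem_image_of_mem _ (mem_univ _))
    have h1 : ∀ i, d i * z none + ratVec (M i) ⬝ᵥ (fun j => z (some j)) ≤ 0 := fun i =>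
      (hf (some i) z).symm.trans_le (hz (f (some i)) (mem_image_of_mem _ (mem_univ _)))
    have hzv : z ⬝ᵥ v = z none * ν + ratVec c ⬝ᵥ fun j => z (some j) := by
      rw [dotProduct_comm (ratVec c)]
      simp [dotProduct, Fintype.sum_option, v]
    rw [hzv]
    set x : κ → ℝ := fun j => z (some j)
    -- If `z none = 0`, `x` is a recession direction, along which `c` cannot grow; otherwise `x`
    -- rescales to a feasible point.
    rcases h0.eq_or_lt with h0 | h0
    · simp only [h0, mul_zero, zero_mul, zero_add] at h1 ⊢
      obtain ⟨x₀, hx₀⟩ := hne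
      by_contra! hpos
      have hray : ∀ t : ℝ, 0 ≤ t → ratVec c ⬝ᵥ x₀ + t * (ratVec c ⬝ᵥ x) ≤ ν := by
        intro t ht
        have := h (x₀ + t • x) fun i => by
          rw [realMat_mulVec_apply, dotProduct_add, dotProduct_smul, smul_eq_mul]
          have := hx₀ i
          rw [realMat_mulVec_apply] at this
          nlinarith [h1 i]
        rwa [dotProduct_add, dotProduct_smul, smul_eq_mul] at this
      have h2 := hray ((ν - ratVec c ⬝ᵥ x₀ + 1) / (ratVec c ⬝ᵥ x))
        (div_nonneg (by linarith [hray 0 le_rfl]) hpos.le)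
      rw [div_mul_cancel₀ _ hpos.ne'] at h2
      linarith
    · have hs : 0 < (-z none)⁻¹ := inv_pos.2 (by linarith)
      have := h ((-z none)⁻¹ • x) fun i => by
        rw [realMat_mulVec_apply, dotProduct_smul, smul_eq_mul, inv_mul_le_iff₀ (by linarith)]
        have := h1 i
        simp only [ratVec] at this ⊢
        linarith
      rw [dotProduct_smul, smul_eq_mul, inv_mul_le_iff₀ (by linarith)] at this
      linarith
  rw [ratCone, coe_image, coe_univ, Set.image_univ, ← Set.range_comp,
    Submodule.mem_span_range_iff_exists_fun] at hv
  obtain ⟨y, hy⟩ := hv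
  refine ⟨fun i => y (some i), fun i => (y (some i)).2, ?_, ?_⟩
  · ext j
    have := congrFun hy (some j)
    simp only [Fintype.sum_option, Finset.sum_apply, Pi.smul_apply, NNReal.smul_def,
      Function.comp_apply, ratVec, f, v, Option.elim, Pi.zero_apply, smul_eq_mul, Rat.cast_zero,
      mul_zero, zero_add] at this
    simp only [Matrix.mulVec, dotProduct, Matrix.transpose_apply, realMat, Matrix.map_apply, ratVec]
    rw [← this]
    exact Finset.sum_congr rfl fun i _ => mul_comm _ _
  · have := congrFun hy none
    simp only [Fintype.sum_option, Finset.sum_apply, Pi.smul_apply, NNReal.smul_def,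
      Function.comp_apply, ratVec, f, v, Option.elim, smul_eq_mul, Rat.cast_one, mul_one] at this
    have h0 := (y none).2
    simp only [dotProduct, ratVec]
    rw [← this, Finset.sum_congr rfl fun i _ => mul_comm (d i : ℝ) _]
    exact le_add_of_nonneg_left h0

theorem dotProduct_le_of_nonneg_combination {M : Matrix ι κ ℚ} {d : ι → ℚ} {x : κ → ℝ}
    {y : ι → ℝ} (hx : realMat M *ᵥ x ≤ ratVec d) (hy : 0 ≤ y) :
    ((realMat M)ᵀ *ᵥ y) ⬝ᵥ x ≤ ratVec d ⬝ᵥ y := by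
  rw [Matrix.mulVec_transpose, ← Matrix.dotProduct_mulVec, dotProduct_comm (ratVec d)]
  exact dotProduct_le_dotProduct_of_nonneg_left hx hy

end Duality

/-! ### Integer support functions and integer points -/

section IntegralSupport

variable {κ : Type*} [Fintype κ]

/-- The support function of `Q` is attained and integer at all integer vectors. -/
def HasIntegralSupport (Q : Set (κ → ℝ)) : Prop :=
  ∀ w : κ → ℤ, ∃ k : ℤ, IsGreatest ((fun x => intVec w ⬝ᵥ x) '' Q) k

/-- Perturb `w` to `w + k • w₀`: the integers `g k - k * h₀` bound `w` from above on the face, and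
compactness shows that the least of them is attained there. -/
theorem HasIntegralSupport.face {Q : Set (κ → ℝ)} (hQ : IsCompact Q) (hs : HasIntegralSupport Q)
    (w₀ : κ → ℤ) (c : ℝ) (hc : ∀ x ∈ Q, intVec w₀ ⬝ᵥ x ≤ c)
    (hne : {x ∈ Q | intVec w₀ ⬝ᵥ x = c}.Nonempty) :
    HasIntegralSupport {x ∈ Q | intVec w₀ ⬝ᵥ x = c} := by
  intro w
  obtain ⟨x₀, hx₀, hx₀c⟩ := hne
  obtain ⟨h₀, ⟨x₁, hx₁, hx₁h⟩, hh⟩ := hs w₀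
  have hch : c = h₀ := le_antisymm (hx₀c ▸ hh ⟨x₀, hx₀, rfl⟩) (hx₁h ▸ hc x₁ hx₁)
  have hw : ∀ (k : ℕ) (x : κ → ℝ),
      intVec (w + k • w₀) ⬝ᵥ x = intVec w ⬝ᵥ x + k * (intVec w₀ ⬝ᵥ x) := by
    intro k x
    simp [intVec, dotProduct, add_mul, Finset.sum_add_distrib, Finset.mul_sum, mul_assoc]
  choose g hg using fun k : ℕ => hs (w + k • w₀)
  have hlow : ∀ k : ℕ, ∀ x ∈ Q, intVec w₀ ⬝ᵥ x = c → intVec w ⬝ᵥ x ≤ ((g k - k * h₀ : ℤ) : ℝ) := by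
    intro k x hx hxc
    have := (hg k).2 ⟨x, hx, rfl⟩
    simp only [hw] at this
    push_cast
    rw [hxc, hch] at this
    linarith
  obtain ⟨r, ⟨K, hK⟩, hr⟩ := Int.exists_least_of_bdd (P := fun r => ∃ k : ℕ, g k - k * h₀ = r)
    ⟨⌊intVec w ⬝ᵥ x₀⌋, by
      rintro _ ⟨k, rfl⟩
      have := (Int.floor_le _).trans (hlow k x₀ hx₀ hx₀c)
      exact_mod_cast this⟩ ⟨_, 0, rfl⟩
  have hcont : ∀ v : κ → ℝ, Continuous fun x : κ → ℝ => v ⬝ᵥ x := fun v => by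
    simp only [dotProduct]; fun_prop
  have hclosed : ∀ k : ℕ,
      IsClosed {x : κ → ℝ | (r : ℝ) ≤ intVec w ⬝ᵥ x + k * (intVec w₀ ⬝ᵥ x - c)} := fun k =>
    isClosed_le continuous_const ((hcont _).add (continuous_const.mul
      ((hcont _).sub continuous_const)))
  -- These sets decrease in `k` because `w₀` is at most `c` on `Q`, and a maximiser for `w + k • w₀`
  -- lies in the `k`-th. A common point has `w`-value at least `r` and must lie on the face.
  obtain ⟨x, hx⟩ := IsCompact.nonempty_iInter_of_sequence_nonempty_isCompact_isClosed
    (fun k : ℕ => Q ∩ {x | (r : ℝ) ≤ intVec w ⬝ᵥ x + k * (intVec w₀ ⬝ᵥ x - c)})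
    (by
      rintro k x ⟨hx, hxr⟩
      refine ⟨hx, ?_⟩
      simp only [Set.mem_ofPred_eq] at hxr ⊢
      push_cast at hxr
      linarith [hc x hx])
    (by
      intro k
      obtain ⟨x, hx, hxg⟩ := (hg k).1
      refine ⟨x, hx, ?_⟩
      have : (r : ℝ) ≤ ((g k - k * h₀ : ℤ) : ℝ) := by exact_mod_cast hr _ ⟨k, rfl⟩
      simp only [hw] at hxg
      push_cast at this
      simp only [Set.mem_ofPred_eq]
      rw [hch]
      linarith)
    (hQ.inter_right (hclosed 0)) (fun k => hQ.isClosed.inter (hclosed k))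
  simp only [Set.mem_iInter, Set.mem_inter_iff, Set.mem_ofPred_eq] at hx
  have hxQ := (hx 0).1
  have hxw : (r : ℝ) ≤ intVec w ⬝ᵥ x := by simpa using (hx 0).2
  have hxc : intVec w₀ ⬝ᵥ x = c := by
    refine le_antisymm (hc x hxQ) ?_
    by_contra! hlt
    obtain ⟨k, hk⟩ := exists_nat_gt ((intVec w ⬝ᵥ x - r) / (c - intVec w₀ ⬝ᵥ x))
    rw [div_lt_iff₀ (by linarith)] at hk
    linarith [(hx k).2]
  have hup : ∀ x ∈ Q, intVec w₀ ⬝ᵥ x = c → intVec w ⬝ᵥ x ≤ r := fun x hx hxc => by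
    rw [← hK]; exact hlow K x hx hxc
  refine ⟨r, ⟨x, ⟨hxQ, hxc⟩, le_antisymm (hup x hxQ hxc) hxw⟩, ?_⟩
  rintro _ ⟨x', ⟨hx', hxc'⟩, rfl⟩
  exact hup x' hx' hxc'

/-- Passing to the face that maximises one coordinate after another fixes every coordinate at an
integer. -/
theorem HasIntegralSupport.exists_intVec_mem {Q : Set (κ → ℝ)} (hQ : IsCompact Q)
    (hs : HasIntegralSupport Q) : ∃ z : κ → ℤ, intVec z ∈ Q := by
  classical
  have key : ∀ s : Finset κ, ∃ F ⊆ Q, IsCompact F ∧ HasIntegralSupport F ∧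
      ∀ i ∈ s, ∃ k : ℤ, ∀ x ∈ F, x i = k := by
    intro s
    induction s using Finset.induction_on with
    | empty => exact ⟨Q, subset_rfl, hQ, hs, by simp⟩
    | insert i s _ ih =>
      obtain ⟨F, hFQ, hF, hFs, hFi⟩ := ih
      have hi : ∀ x : κ → ℝ, intVec (Pi.single i 1) ⬝ᵥ x = x i := fun x => by
        have : intVec (Pi.single i 1 : κ → ℤ) = Pi.single i 1 := by
          ext j; by_cases h : j = i
          · subst h; simp [intVec]
          · simp [intVec, h]
        rw [this, single_one_dotProduct]
      obtain ⟨k, ⟨x, hx, hxk⟩, hk⟩ := hFs (Pi.single i 1)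
      refine ⟨_, (Set.sep_subset F _).trans hFQ, ?_, hFs.face hF (Pi.single i 1) k
        (fun x hx => hk ⟨x, hx, rfl⟩) ⟨x, hx, hxk⟩, ?_⟩
      · refine hF.inter_right (isClosed_eq (f := fun x => intVec (Pi.single i 1) ⬝ᵥ x) ?_
          continuous_const)
        simp only [hi]; fun_prop
      · intro j hj
        rcases Finset.mem_insert.1 hj with rfl | hj
        · exact ⟨k, fun x hx => (hi x).symm.trans hx.2⟩
        · obtain ⟨k', hk'⟩ := hFi j hj
          exact ⟨k', fun x hx => hk' x hx.1⟩
  obtain ⟨F, hFQ, -, hFs, hFi⟩ := key univ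
  obtain ⟨_, ⟨x, hx, -⟩, -⟩ := hFs 0
  choose z hz using fun i => hFi i (mem_univ i)
  refine ⟨z, ?_⟩
  have : intVec z = x := by ext i; exact (hz i x hx).symm
  rw [this]; exact hFQ hx

theorem exists_intVec_eq_smul_ratVec (a : κ → ℚ) :
    ∃ N : ℕ, 0 < N ∧ ∃ z : κ → ℤ, intVec z = (N : ℝ) • ratVec a := by
  refine ⟨∏ i, (a i).den, Finset.prod_pos fun i _ => (a i).pos, ?_⟩
  have : ∀ i, ∃ k : ℤ, (k : ℚ) = ((∏ j, (a j).den : ℕ) : ℚ) * a i := by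
    intro i
    obtain ⟨q, hq⟩ := Finset.dvd_prod_of_mem (fun j => (a j).den) (mem_univ i)
    refine ⟨q * (a i).num, ?_⟩
    rw [hq]
    push_cast
    rw [mul_right_comm, Rat.den_mul_eq_num]
    ring
  choose z hz using this
  refine ⟨z, ?_⟩
  ext i
  simp only [intVec, ratVec, Pi.smul_apply, smul_eq_mul]
  exact_mod_cast congrArg (fun q : ℚ => (q : ℝ)) (hz i)

/-- A compact rational polyhedron with integral support function is integer. -/
theorem isIntegerPolyhedron_of_hasIntegralSupport {n : ℕ} {Q : Set (Fin n → ℝ)}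
    (hP : IsPolyhedron Q) (hQ : IsCompact Q) (hs : Q.Nonempty → HasIntegralSupport Q) :
    IsIntegerPolyhedron Q := by
  classical
  refine ⟨hP, ?_⟩
  rintro F ⟨hFne, m, A, b, I, rfl, rfl⟩
  obtain ⟨x₀, hx₀, hx₀I⟩ := hFne
  -- The sum of the rows in `I` exposes the face: a sum of nonnegative slacks vanishes only if each
  -- does. Scaling makes this normal integer.
  obtain ⟨N, hN, w, hw⟩ := exists_intVec_eq_smul_ratVec (∑ i with i ∈ I, A i)
  have hN' : (0 : ℝ) < N := by exact_mod_cast hN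
  have hval : ∀ x, intVec w ⬝ᵥ x = N * ∑ i with i ∈ I, (realMat A *ᵥ x) i := by
    intro x
    have : ratVec (∑ i with i ∈ I, A i) = ∑ i with i ∈ I, ratVec (A i) := by
      ext j
      exact (congrArg (Rat.cast : ℚ → ℝ) (Finset.sum_apply j _ A)).trans (by simp [ratVec])
    rw [hw, smul_dotProduct, this, sum_dotProduct, smul_eq_mul]
    rfl
  have hF : {x | x ∈ polyhedron A b ∧ ∀ i ∈ I, (realMat A *ᵥ x) i = ratVec b i} =
      {x ∈ polyhedron A b | intVec w ⬝ᵥ x = N * ∑ i with i ∈ I, ratVec b i} := by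
    ext x
    refine and_congr_right fun hx => ?_
    rw [hval, mul_right_inj' hN'.ne', Finset.sum_eq_sum_iff_of_le fun i _ => hx i]
    simp
  have hx₁ : x₀ ∈ {x ∈ polyhedron A b | intVec w ⬝ᵥ x = N * ∑ i with i ∈ I, ratVec b i} :=
    hF ▸ ⟨hx₀, hx₀I⟩
  rw [hF]
  refine HasIntegralSupport.exists_intVec_mem ?_ ((hs ⟨x₀, hx₀⟩).face hQ w _ ?_ ⟨x₀, hx₁⟩)
  · refine hQ.inter_right (isClosed_eq (f := fun x => intVec w ⬝ᵥ x) ?_ continuous_const)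
    simp only [dotProduct]; fun_prop
  · intro x hx
    rw [hval]
    exact mul_le_mul_of_nonneg_left (Finset.sum_le_sum fun i _ => hx i) hN'.le

end IntegralSupport

/-! ### Box-TDI cones are box-integer -/

section Box

variable {n : ℕ}

theorem isPolyhedron_polyhedron {ι : Type*} [Fintype ι] (A : Matrix ι (Fin n) ℚ) (b : ι → ℚ) :
    IsPolyhedron (polyhedron A b) := by
  let e := Fintype.equivFin ι
  refine ⟨Fintype.card ι, A.submatrix e.symm id, b ∘ e.symm, ?_⟩
  ext x
  exact (e.symm.forall_congr_right (q := fun i => (realMat A *ᵥ x) i ≤ ratVec b i)).symm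

theorem mem_polyhedron_box {ι : Type*} {A : Matrix ι (Fin n) ℚ} {b : ι → ℚ} {l u : Fin n → ℚ}
    {x : Fin n → ℝ} : x ∈ polyhedron (boxMatrix A) (boxRhs b l u) ↔
      x ∈ polyhedron A b ∧ ratVec l ≤ x ∧ x ≤ ratVec u := by
  have h1 : ∀ j, ratVec ((1 : Matrix (Fin n) (Fin n) ℚ) j) ⬝ᵥ x = x j := fun j => by
    have : ratVec ((1 : Matrix (Fin n) (Fin n) ℚ) j) = Pi.single j 1 := by
      ext i; simp [ratVec, Matrix.one_apply, Pi.single_apply, eq_comm, apply_ite (Rat.cast : ℚ → ℝ)]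
    rw [this, single_one_dotProduct]
  have h2 : ∀ j, ratVec ((-1 : Matrix (Fin n) (Fin n) ℚ) j) ⬝ᵥ x = -x j := fun j => by
    have : ratVec ((-1 : Matrix (Fin n) (Fin n) ℚ) j) =
        -ratVec ((1 : Matrix (Fin n) (Fin n) ℚ) j) := by
      ext i; simp [ratVec]
    rw [this, neg_dotProduct, h1]
  simp only [polyhedron, Set.mem_ofPred_eq, Pi.le_def, Sum.forall, realMat_mulVec_apply]
  refine and_congr_right fun _ => ?_
  rw [and_comm]
  refine and_congr (forall_congr' fun j => ?_) (forall_congr' fun j => ?_)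
  · change ratVec ((-1 : Matrix (Fin n) (Fin n) ℚ) j) ⬝ᵥ x ≤ (((-l) j : ℚ) : ℝ) ↔ _
    rw [h2]
    simp [ratVec]
  · change ratVec ((1 : Matrix (Fin n) (Fin n) ℚ) j) ⬝ᵥ x ≤ _ ↔ _
    rw [h1]
    rfl

theorem boxMatrix_transpose_mulVec {ι : Type*} [Fintype ι] (A : Matrix ι (Fin n) ℚ)
    (y : ι ⊕ (Fin n ⊕ Fin n) → ℝ) (j : Fin n) :
    ((realMat (boxMatrix A))ᵀ *ᵥ y) j =
      ((realMat A)ᵀ *ᵥ fun i => y (.inl i)) j + y (.inr (.inl j)) - y (.inr (.inr j)) := by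
  simp [Matrix.mulVec, dotProduct, Fintype.sum_sum_type, realMat, boxMatrix, Matrix.one_apply,
    apply_ite (Rat.cast : ℚ → ℝ), add_assoc, sub_eq_add_neg]

theorem boxRhs_dotProduct {ι : Type*} [Fintype ι] (b : ι → ℚ) (l u : Fin n → ℚ)
    (y : ι ⊕ (Fin n ⊕ Fin n) → ℝ) :
    ratVec (boxRhs b l u) ⬝ᵥ y = ratVec b ⬝ᵥ (fun i => y (.inl i)) +
      ∑ j, (u j * y (.inr (.inl j)) - l j * y (.inr (.inr j))) := by
  simp [dotProduct, Fintype.sum_sum_type, ratVec, boxRhs,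
    Finset.sum_add_distrib, sub_eq_add_neg]

theorem isCompact_polyhedron_inter_box {P : Set (Fin n → ℝ)} (hP : IsPolyhedron P)
    (a b : Fin n → ℝ) : IsCompact (P ∩ {x | a ≤ x ∧ x ≤ b}) := by
  obtain ⟨m, A, b', rfl⟩ := hP
  refine (isCompact_Icc (a := a) (b := b)).inter_left ?_
  exact isClosed_le (Continuous.matrix_mulVec continuous_const continuous_id) continuous_const

/-- A box-TDI cone is box-integer. -/
theorem IsBoxTDI.isBoxInteger {P : Set (Fin n → ℝ)}
    (hsmul : ∀ x ∈ P, ∀ t : ℝ, 0 ≤ t → t • x ∈ P) (h : IsBoxTDI P) : IsBoxInteger P := by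
  obtain ⟨m, A, b, rfl, htdi⟩ := h
  have hP : IsPolyhedron (polyhedron A b) := ⟨m, A, b, rfl⟩
  refine ⟨hP, fun l u => ?_⟩
  let l' : Fin n → ℚ := fun j => l j
  let u' : Fin n → ℚ := fun j => u j
  have hbox : polyhedron A b ∩ {x | intVec l ≤ x ∧ x ≤ intVec u} =
      polyhedron (boxMatrix A) (boxRhs b l' u') := by
    ext x
    rw [mem_polyhedron_box]
    simp [Pi.le_def, intVec, ratVec, l', u']
  have hcomp := isCompact_polyhedron_inter_box hP (intVec l) (intVec u)
  refine isIntegerPolyhedron_of_hasIntegralSupport (hbox ▸ isPolyhedron_polyhedron _ _) hcomp ?_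
  intro hne w
  have hcont : Continuous fun x : Fin n → ℝ => intVec w ⬝ᵥ x := by
    simp only [dotProduct]; fun_prop
  obtain ⟨x, hx, hmax⟩ := hcomp.exists_isMaxOn hne hcont.continuousOn
  have hx' := hx
  rw [hbox] at hx'
  have hmax' : ∀ x' ∈ polyhedron (boxMatrix A) (boxRhs b l' u'),
      intVec w ⬝ᵥ x' ≤ intVec w ⬝ᵥ x := fun x' hx' => hmax (hbox ▸ hx')
  have hw : ratVec (fun j => (w j : ℚ)) = intVec w := by ext; simp [ratVec, intVec]
  obtain ⟨y, hy0, hyw, hyx⟩ := exists_nonneg_combination (boxMatrix A) (boxRhs b l' u')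
    (fun j => (w j : ℚ)) (intVec w ⬝ᵥ x) ⟨x, hx'⟩ (by rw [hw]; exact hmax')
  rw [hw] at hyw
  have hweak : ∀ y ∈ dualFeasible (boxMatrix A) w,
      intVec w ⬝ᵥ x ≤ ratVec (boxRhs b l' u') ⬝ᵥ y := fun y hy => by
    rw [← hy.1]; exact dotProduct_le_of_nonneg_combination hx' hy.2
  obtain ⟨z, hz, hzmin⟩ := htdi l' u' w ⟨y, hyw, hy0⟩
    ⟨intVec w ⬝ᵥ x, by rintro _ ⟨y, hy, rfl⟩; exact hweak y hy⟩
  have hzx := (hzmin y ⟨hyw, hy0⟩).trans hyx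
  -- As `P` contains 0 and the ray through `x`, `b ≥ 0` and `A x ≤ 0`. The first bounds the box part
  -- of the dual value above by `w ⬝ᵥ x`, the second below. That part is an integer even if `b` is
  -- not.
  have hb : 0 ≤ ratVec b := by
    have := hsmul x hx.1 0 le_rfl
    rw [zero_smul] at this
    simpa [polyhedron] using this
  have hA : realMat A *ᵥ x ≤ 0 := by
    intro i
    by_contra! hpos
    rw [Pi.zero_apply] at hpos
    have hb' := hb i
    have hlt : 0 ≤ (ratVec b i + 1) / (realMat A *ᵥ x) i :=
      div_nonneg (by simp only [Pi.zero_apply] at hb'; linarith) hpos.le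
    have := hsmul x hx.1 _ hlt i
    rw [Matrix.mulVec_smul, Pi.smul_apply, smul_eq_mul, div_mul_cancel₀ _ hpos.ne'] at this
    linarith
  have hz0 := hz.2
  have hbz : 0 ≤ ratVec b ⬝ᵥ (fun i => intVec z (.inl i)) :=
    dotProduct_nonneg_of_nonneg hb fun i => hz0 (.inl i)
  rw [boxRhs_dotProduct] at hzx
  have hle : intVec w ⬝ᵥ x ≤
      ∑ j, ((u' j : ℝ) * intVec z (.inr (.inl j)) - l' j * intVec z (.inr (.inr j))) := by
    rw [← hz.1]
    have h1 : ((realMat A)ᵀ *ᵥ fun i => intVec z (.inl i)) ⬝ᵥ x ≤ 0 := by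
      rw [Matrix.mulVec_transpose, ← Matrix.dotProduct_mulVec]
      exact (dotProduct_le_dotProduct_of_nonneg_left hA fun i => hz0 (.inl i)).trans_eq
        (dotProduct_zero _)
    have h2 : ((realMat (boxMatrix A))ᵀ *ᵥ intVec z) ⬝ᵥ x =
        ((realMat A)ᵀ *ᵥ fun i => intVec z (.inl i)) ⬝ᵥ x +
          ∑ j, (intVec z (.inr (.inl j)) - intVec z (.inr (.inr j))) * x j := by
      simp only [dotProduct, boxMatrix_transpose_mulVec, ← Finset.sum_add_distrib]
      exact Finset.sum_congr rfl fun j _ => by ring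
    rw [h2]
    refine (add_le_of_nonpos_left h1).trans (Finset.sum_le_sum fun j _ => ?_)
    have hl := hx.2.1 j
    have hu := hx.2.2 j
    have hs := hz0 (.inr (.inl j))
    have ht := hz0 (.inr (.inr j))
    simp only [Pi.zero_apply] at hs ht
    have hl' : (l' j : ℝ) ≤ x j := by simpa [intVec, l'] using hl
    have hu' : x j ≤ (u' j : ℝ) := by simpa [intVec, u'] using hu
    nlinarith [mul_le_mul_of_nonneg_left hl' ht, mul_le_mul_of_nonneg_left hu' hs]
  refine ⟨∑ j, (u j * z (.inr (.inl j)) - l j * z (.inr (.inr j))), ⟨x, hx, ?_⟩, ?_⟩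
  · simp only [intVec, u', l', Rat.cast_intCast] at hle hzx hbz ⊢
    push_cast
    linarith
  · rintro _ ⟨x', hx', rfl⟩
    refine (hmax hx').trans (hle.trans_eq ?_)
    simp [intVec, u', l']

end Box

/-! ### Linear optima on faces -/

section Optimum

/-- A linear function bounded below on a polyhedron is, on some face, at most its value at a given
point. -/
theorem exists_face_le {m n : ℕ} (A : Matrix (Fin m) (Fin n) ℚ) (b : Fin m → ℚ) (c : Fin n → ℝ)
    (B : ℝ) (hB : ∀ x ∈ polyhedron A b, B ≤ c ⬝ᵥ x) {x₀ : Fin n → ℝ} (hx₀ : x₀ ∈ polyhedron A b) :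
    ∃ I : Set (Fin m),
      {x | x ∈ polyhedron A b ∧ ∀ i ∈ I, (realMat A *ᵥ x) i = ratVec b i}.Nonempty ∧
      ∀ x ∈ polyhedron A b, (∀ i ∈ I, (realMat A *ᵥ x) i = ratVec b i) → c ⬝ᵥ x ≤ c ⬝ᵥ x₀ := by
  classical
  let t : (Fin n → ℝ) → Finset (Fin m) := fun x =>
    univ.filter fun i => (realMat A *ᵥ x) i = ratVec b i
  -- Among points no costlier than `x₀`, take one with the most tight rows.
  obtain ⟨x, ⟨hx, hxc⟩, hmax⟩ := (measure fun x => m - (t x).card).wf.has_min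
    {x | x ∈ polyhedron A b ∧ c ⬝ᵥ x ≤ c ⬝ᵥ x₀} ⟨x₀, hx₀, le_rfl⟩
  refine ⟨{i | (realMat A *ᵥ x) i = ratVec b i}, ⟨x, hx, fun i hi => hi⟩, fun x' hx' hI => ?_⟩
  by_contra! hlt
  -- Moving from `x` away from a costlier `x'` lowers the cost and keeps tight rows tight;
  -- boundedness forces a new row to become tight.
  set d := x - x' with hd
  have hcd : c ⬝ᵥ d < 0 := by rw [hd, dotProduct_sub]; linarith
  have hAx : ∀ (s : ℝ) i,
      (realMat A *ᵥ (x + s • d)) i = (realMat A *ᵥ x) i + s * (realMat A *ᵥ d) i := fun s i => by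
    simp [Matrix.mulVec_add, Matrix.mulVec_smul]
  have hcx : ∀ s : ℝ, c ⬝ᵥ (x + s • d) = c ⬝ᵥ x + s * (c ⬝ᵥ d) := fun s => by
    simp [dotProduct_add, dotProduct_smul]
  have hdI : ∀ i, (realMat A *ᵥ x) i = ratVec b i → (realMat A *ᵥ d) i = 0 := fun i hi => by
    rw [hd, Matrix.mulVec_sub, Pi.sub_apply, hi, hI i hi, sub_self]
  have hpos : (univ.filter fun i => 0 < (realMat A *ᵥ d) i).Nonempty := by
    by_contra hemp
    rw [Finset.not_nonempty_iff_eq_empty, Finset.filter_eq_empty_iff] at hemp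
    have hray : ∀ s : ℝ, 0 ≤ s → x + s • d ∈ polyhedron A b := fun s hs i => by
      rw [hAx]
      have := hemp (mem_univ i)
      have := hx i
      nlinarith
    have hs : 0 ≤ (B - c ⬝ᵥ x - 1) / (c ⬝ᵥ d) :=
      div_nonneg_of_nonpos (by linarith [hB x hx]) hcd.le
    have := hB _ (hray _ hs)
    rw [hcx, div_mul_cancel₀ _ hcd.ne] at this
    linarith
  obtain ⟨i₀, hi₀, hmin⟩ := Finset.exists_min_image _
    (fun i => (ratVec b i - (realMat A *ᵥ x) i) / (realMat A *ᵥ d) i) hpos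
  replace hi₀ := (mem_filter.1 hi₀).2
  set s := (ratVec b i₀ - (realMat A *ᵥ x) i₀) / (realMat A *ᵥ d) i₀ with hs
  have hs0 : 0 ≤ s := div_nonneg (sub_nonneg.2 (hx i₀)) hi₀.le
  have hmem : x + s • d ∈ polyhedron A b := fun i => by
    rw [hAx]
    rcases le_or_gt ((realMat A *ᵥ d) i) 0 with hi | hi
    · have := hx i
      nlinarith
    · have := hmin i (mem_filter.2 ⟨mem_univ i, hi⟩)
      rw [le_div_iff₀ hi] at this
      linarith
  refine hmax (x + s • d) ⟨hmem, ?_⟩ ?_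
  · rw [hcx]; nlinarith
  · have hss : t x ⊂ t (x + s • d) := by
      refine Finset.ssubset_iff_of_subset ?_ |>.2 ⟨i₀, ?_, ?_⟩
      · intro i hi
        have hi := (mem_filter.1 hi).2
        exact mem_filter.2 ⟨mem_univ i, by rw [hAx, hdI i hi, mul_zero, add_zero, hi]⟩
      · refine mem_filter.2 ⟨mem_univ _, ?_⟩
        rw [hAx, hs, div_mul_cancel₀ _ hi₀.ne']
        ring
      · intro hi
        exact hi₀.ne' (hdI i₀ (mem_filter.1 hi).2)
    have h1 := Finset.card_lt_card hss
    have h2 : (t (x + s • d)).card ≤ m := (card_le_univ _).trans_eq (Fintype.card_fin m)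
    change m - (t (x + s • d)).card < m - (t x).card
    omega

/-- On a compact integer polyhedron, every value of a linear function is at least its value at
some integer point. -/
theorem IsIntegerPolyhedron.exists_intVec_le {n : ℕ} {Q : Set (Fin n → ℝ)}
    (hQ : IsIntegerPolyhedron Q) (hc : IsCompact Q) (c : Fin n → ℝ) {x : Fin n → ℝ} (hx : x ∈ Q) :
    ∃ z : Fin n → ℤ, intVec z ∈ Q ∧ c ⬝ᵥ intVec z ≤ c ⬝ᵥ x := by
  obtain ⟨⟨m, A, b, rfl⟩, hface⟩ := hQ
  have hcont : Continuous fun x : Fin n → ℝ => c ⬝ᵥ x := by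
    simp only [dotProduct]; fun_prop
  obtain ⟨x₁, -, hmin⟩ := hc.exists_isMinOn ⟨x, hx⟩ hcont.continuousOn
  obtain ⟨I, hne, hI⟩ := exists_face_le A b c (c ⬝ᵥ x₁) (fun x hx => hmin hx) hx
  obtain ⟨z, hz, hzI⟩ := hface _ ⟨hne, m, A, b, I, rfl, rfl⟩
  exact ⟨z, hz, hI _ hz hzI⟩

end Optimum

/-! ### Hilbert bases -/

section HilbertBasis

variable {κ : Type*} [Fintype κ]

/-- Integer points of a cone generated by rational vectors form a finitely generated monoid. -/
theorem exists_hilbertBasis (T : Finset (κ → ℚ)) :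
    ∃ H : Finset (κ → ℤ), (∀ h ∈ H, intVec h ∈ ratCone T) ∧
      ∀ z : κ → ℤ, intVec z ∈ ratCone T → z ∈ AddSubmonoid.closure (H : Set (κ → ℤ)) := by
  classical
  choose N hN g hg using fun a : κ → ℚ => exists_intVec_eq_smul_ratVec a
  have hgmem : ∀ a ∈ T, ∀ c : ℝ, 0 ≤ c → c • intVec (g a) ∈ ratCone T := by
    intro a ha c hc
    have := (ratCone T).smul_mem (c * N a).toNNReal (ratVec_mem_ratCone ha)
    rwa [NNReal.smul_def, Real.coe_toNNReal _ (by positivity), ← smul_smul, ← hg] at this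
  -- Integer points of the zonotope of the generators. Allowing `y a = 1` puts the generators
  -- themselves in it.
  let Z : Set (κ → ℤ) := {h | ∃ y : (κ → ℚ) → ℝ, (∀ a, 0 ≤ y a ∧ y a ≤ 1) ∧
    intVec h = ∑ a ∈ T, y a • intVec (g a)}
  have hZ : Z.Finite := by
    refine (Set.finite_Icc (-∑ a ∈ T, |g a|) (∑ a ∈ T, |g a|)).subset ?_
    rintro h ⟨y, hy, hh⟩
    have habs : ∀ i, |h i| ≤ (∑ a ∈ T, |g a|) i := by
      intro i
      have : |(h i : ℝ)| ≤ ∑ a ∈ T, |(g a i : ℝ)| := by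
        have hi := congrFun hh i
        simp only [intVec, Finset.sum_apply, Pi.smul_apply, smul_eq_mul] at hi
        rw [hi]
        refine (Finset.abs_sum_le_sum_abs _ _).trans (Finset.sum_le_sum fun a _ => ?_)
        rw [abs_mul, abs_of_nonneg (hy a).1]
        exact mul_le_of_le_one_left (abs_nonneg _) (hy a).2
      rw [Finset.sum_apply]
      exact_mod_cast this
    exact ⟨fun i => (abs_le.1 (habs i)).1, fun i => (abs_le.1 (habs i)).2⟩
  refine ⟨hZ.toFinset, fun h hh => ?_, fun z hz => ?_⟩
  · obtain ⟨y, hy, hh⟩ := hZ.mem_toFinset.1 hh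
    rw [hh]
    exact sum_mem fun a ha => hgmem a ha _ (hy a).1
  · rw [ratCone, Submodule.mem_span_image_finset_iff_exists_fun'] at hz
    obtain ⟨c, hc⟩ := hz
    let y : (κ → ℚ) → ℝ := fun a => c a / N a
    have hy0 : ∀ a, 0 ≤ y a := fun a => by positivity
    have hyz : intVec z = ∑ a ∈ T, y a • intVec (g a) := by
      rw [← hc]
      refine Finset.sum_congr rfl fun a _ => ?_
      have : (N a : ℝ) ≠ 0 := by exact_mod_cast (hN a).ne'
      rw [hg, smul_smul, NNReal.smul_def, div_mul_cancel₀ _ this]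
    have hgZ : ∀ a ∈ T, g a ∈ AddSubmonoid.closure (hZ.toFinset : Set (κ → ℤ)) := fun a ha => by
      refine AddSubmonoid.subset_closure (hZ.mem_toFinset.2 ⟨Pi.single a 1, fun a' => ?_, ?_⟩)
      · by_cases h : a' = a
        · subst h; simp
        · simp [h]
      · rw [Finset.sum_eq_single_of_mem a ha fun a' _ h => by simp [h]]
        simp
    have hr : z - ∑ a ∈ T, ⌊y a⌋₊ • g a ∈ Z := by
      refine ⟨fun a => y a - ⌊y a⌋₊, fun a => ⟨sub_nonneg.2 (Nat.floor_le (hy0 a)), ?_⟩, ?_⟩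
      · linarith [Nat.lt_floor_add_one (y a)]
      · have : intVec (z - ∑ a ∈ T, ⌊y a⌋₊ • g a) =
            intVec z - ∑ a ∈ T, (⌊y a⌋₊ : ℝ) • intVec (g a) := by
          ext i; simp [intVec, Finset.sum_apply]
        rw [this, hyz, ← Finset.sum_sub_distrib]
        exact Finset.sum_congr rfl fun a _ => by rw [sub_smul]
    have := add_mem (AddSubmonoid.subset_closure (hZ.mem_toFinset.2 hr))
      (sum_mem fun a ha => nsmul_mem (hgZ a ha) ⌊y a⌋₊)
    rwa [sub_add_cancel] at this

end HilbertBasis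

/-! ### Polars of box-integer cones are box-TDI -/

section BoxTDICone

variable {n : ℕ}

/-- The value of the cheapest box multipliers for the residual `w - x`. -/
noncomputable def boxCost (l u : Fin n → ℚ) (w : Fin n → ℤ) (x : Fin n → ℝ) : ℝ :=
  ∑ j, max ((u j : ℝ) * (w j - x j)) (l j * (w j - x j))

/-- With `s - t = w - x`, the objective exceeds the two terms of the maximum by `(u - l) t` and `(u
- l) s`. Positive and negative parts attain the bound. -/
theorem boxCost_le {l u : Fin n → ℚ} (hlu : l ≤ u) (w : Fin n → ℤ) (x s t : Fin n → ℝ)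
    (hs : 0 ≤ s) (ht : 0 ≤ t) (h : ∀ j, x j + s j - t j = w j) :
    boxCost l u w x ≤ ∑ j, (u j * s j - l j * t j) := by
  refine Finset.sum_le_sum fun j _ => ?_
  have hj : (l j : ℝ) ≤ u j := by exact_mod_cast hlu j
  have hs := hs j
  have ht := ht j
  simp only [Pi.zero_apply] at hs ht
  rw [show (w j : ℝ) - x j = s j - t j by linarith [h j]]
  refine max_le ?_ ?_ <;> nlinarith

theorem boxCost_intVec_eq {l u : Fin n → ℚ} (hlu : l ≤ u) (w z : Fin n → ℤ) :
    boxCost l u w (intVec z) =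
      ∑ j, ((u j : ℝ) * ((w j - z j)⁺ : ℤ) - l j * ((w j - z j)⁻ : ℤ)) := by
  refine Finset.sum_congr rfl fun j => fun _ => ?_
  have hj : (l j : ℝ) ≤ u j := by exact_mod_cast hlu j
  rcases le_total 0 (w j - z j) with h | h
  · have h' : (0 : ℝ) ≤ w j - intVec z j := by simp only [intVec]; exact_mod_cast h
    rw [posPart_of_nonneg h, negPart_of_nonneg h, max_eq_left (mul_le_mul_of_nonneg_right hj h')]
    simp [intVec]
  · have h' : w j - intVec z j ≤ 0 := by simp only [intVec]; exact_mod_cast h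
    rw [posPart_of_nonpos h, negPart_of_nonpos h, max_eq_right (mul_le_mul_of_nonpos_right hj h')]
    simp [intVec]
    ring

/-- `boxCost` is affine on unit boxes with integer corners. -/
theorem exists_boxCost_eq_on_unit_box {l u : Fin n → ℚ} (hlu : l ≤ u) (w k : Fin n → ℤ) :
    ∃ c : Fin n → ℝ, ∃ e : ℝ, ∀ x : Fin n → ℝ, intVec k ≤ x → x ≤ intVec (k + 1) →
      boxCost l u w x = c ⬝ᵥ x + e := by
  -- The slope in coordinate `j` changes only at the integer `w j`, never inside `[k j, k j + 1]`.
  let c : Fin n → ℝ := fun j => if k j < w j then -(u j : ℝ) else -(l j : ℝ)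
  refine ⟨c, -∑ j, c j * w j, fun x hk hk' => ?_⟩
  rw [dotProduct, ← sub_eq_add_neg, ← Finset.sum_sub_distrib]
  refine Finset.sum_congr rfl fun j _ => ?_
  have hj : (l j : ℝ) ≤ u j := by exact_mod_cast hlu j
  have hkj : (k j : ℝ) ≤ x j := hk j
  have hkj' : x j ≤ k j + 1 := by simpa [intVec] using hk' j
  by_cases h : k j < w j
  · have h' : (k j : ℝ) + 1 ≤ w j := by exact_mod_cast h
    rw [max_eq_left (mul_le_mul_of_nonneg_right hj (by linarith))]
    simp only [c, if_pos h]
    ring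
  · have h' : (w j : ℝ) ≤ k j := by exact_mod_cast not_lt.1 h
    rw [max_eq_right (mul_le_mul_of_nonpos_right hj (by linarith))]
    simp only [c, if_neg h]
    ring

/-- Rounds `x` within its unit box, where the cost is affine. -/
theorem exists_intVec_boxCost_le {D : Set (Fin n → ℝ)} (hD : IsBoxInteger D) {l u : Fin n → ℚ}
    (hlu : l ≤ u) (w : Fin n → ℤ) {x : Fin n → ℝ} (hx : x ∈ D) :
    ∃ z : Fin n → ℤ, intVec z ∈ D ∧ boxCost l u w (intVec z) ≤ boxCost l u w x := by
  let k : Fin n → ℤ := fun j => ⌊x j⌋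
  obtain ⟨c, e, hce⟩ := exists_boxCost_eq_on_unit_box hlu w k
  have hk : intVec k ≤ x := fun j => Int.floor_le _
  have hk' : x ≤ intVec (k + 1) := fun j => by
    simpa [intVec, k] using (Int.lt_floor_add_one (x j)).le
  obtain ⟨z, ⟨hzD, hzk, hzk'⟩, hz⟩ := (hD.2 k (k + 1)).exists_intVec_le
    (isCompact_polyhedron_inter_box hD.1 _ _) c ⟨hx, hk, hk'⟩
  exact ⟨z, hzD, by rw [hce _ hzk hzk', hce x hk hk']; linarith⟩

theorem exists_int_eq_mul_boxCost {l u : Fin n → ℚ} (hlu : l ≤ u) (w : Fin n → ℤ) :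
    ∃ N : ℝ, 0 < N ∧ ∀ z : Fin n → ℤ, ∃ k : ℤ, N * boxCost l u w (intVec z) = k := by
  obtain ⟨N, hN, v, hv⟩ := exists_intVec_eq_smul_ratVec (Sum.elim l u)
  refine ⟨N, by exact_mod_cast hN, fun z =>
    ⟨∑ j, (v (.inr j) * (w j - z j)⁺ - v (.inl j) * (w j - z j)⁻), ?_⟩⟩
  have h1 : ∀ j, (v (.inl j) : ℝ) = N * l j := fun j => congrFun hv (.inl j)
  have h2 : ∀ j, (v (.inr j) : ℝ) = N * u j := fun j => congrFun hv (.inr j)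
  rw [boxCost_intVec_eq hlu, Finset.mul_sum]
  push_cast
  refine Finset.sum_congr rfl fun j _ => ?_
  rw [h1, h2]
  ring

/-- Costs at integer points are multiples of a fixed `1 / N`, so boundedness below gives a least
one; rounding extends minimality to all of `D`. -/
theorem exists_intVec_boxCost_min {D : Set (Fin n → ℝ)} (hD : IsBoxInteger D) {l u : Fin n → ℚ}
    (hlu : l ≤ u) (w : Fin n → ℤ) (hne : D.Nonempty)
    (hbdd : ∃ B, ∀ z : Fin n → ℤ, intVec z ∈ D → B ≤ boxCost l u w (intVec z)) :
    ∃ z : Fin n → ℤ, intVec z ∈ D ∧ ∀ x ∈ D, boxCost l u w (intVec z) ≤ boxCost l u w x := by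
  obtain ⟨N, hN, hint⟩ := exists_int_eq_mul_boxCost hlu w
  choose f hf using hint
  obtain ⟨B, hB⟩ := hbdd
  obtain ⟨x₀, hx₀⟩ := hne
  obtain ⟨z₀, hz₀, -⟩ := exists_intVec_boxCost_le hD hlu w hx₀
  obtain ⟨r, ⟨z, hz, hzr⟩, hr⟩ := Int.exists_least_of_bdd (P := fun r => ∃ z, intVec z ∈ D ∧ f z = r)
    ⟨⌊N * B⌋, by
      rintro _ ⟨z, hz, rfl⟩
      have := (Int.floor_le (N * B)).trans
        ((mul_le_mul_of_nonneg_left (hB z hz) hN.le).trans_eq (hf z))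
      exact_mod_cast this⟩ ⟨_, z₀, hz₀, rfl⟩
  refine ⟨z, hz, fun x hx => ?_⟩
  obtain ⟨z', hz', hz'x⟩ := exists_intVec_boxCost_le hD hlu w hx
  refine le_trans ?_ hz'x
  rw [← mul_le_mul_iff_right₀ hN, hf, hf, hzr]
  exact_mod_cast hr _ ⟨z', hz', rfl⟩

/-- If `u j < l j`, raising both multipliers of coordinate `j` equally preserves feasibility and
drives the objective to `-∞`. -/
theorem le_of_bddBelow_dual {ι : Type*} [Fintype ι] {A : Matrix ι (Fin n) ℚ} {b : ι → ℚ}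
    {l u : Fin n → ℚ} {w : Fin n → ℤ} (hne : (dualFeasible (boxMatrix A) w).Nonempty)
    (hbdd : BddBelow ((fun y => ratVec (boxRhs b l u) ⬝ᵥ y) '' dualFeasible (boxMatrix A) w)) :
    l ≤ u := by
  classical
  intro j
  by_contra! hlt
  have hlt' : (0 : ℝ) < l j - u j := sub_pos.2 (by exact_mod_cast hlt)
  obtain ⟨y, hyw, hy0⟩ := hne
  obtain ⟨B, hB⟩ := hbdd
  set val := ratVec (boxRhs b l u) ⬝ᵥ y with hval
  let d : ι ⊕ (Fin n ⊕ Fin n) → ℝ := Sum.elim 0 (Sum.elim (Pi.single j 1) (Pi.single j 1))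
  have hd0 : 0 ≤ d := by
    rintro (i | i | i)
    · exact le_rfl
    · by_cases h : i = j
      · subst h; simp [d]
      · simp [d, h]
    · by_cases h : i = j
      · subst h; simp [d]
      · simp [d, h]
  have hdA : (realMat (boxMatrix A))ᵀ *ᵥ d = 0 := by
    ext i
    rw [boxMatrix_transpose_mulVec]
    simp only [d, Sum.elim_inl, Sum.elim_inr, Pi.zero_apply, add_sub_cancel_right]
    exact congrFun (Matrix.mulVec_zero _) i
  have hdb : ratVec (boxRhs b l u) ⬝ᵥ d = u j - l j := by
    rw [boxRhs_dotProduct]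
    simp only [d, Sum.elim_inl, Sum.elim_inr, Finset.sum_sub_distrib]
    rw [show (fun i : ι => (0 : ι → ℝ) i) = 0 from rfl, dotProduct_zero]
    simp [Pi.single_apply]
  have hray : ∀ s : ℝ, 0 ≤ s → B ≤ val + s * (u j - l j) := by
    intro s hs
    have := hB ⟨y + s • d, ⟨by rw [Matrix.mulVec_add, Matrix.mulVec_smul, hdA, smul_zero, add_zero,
      hyw], add_nonneg hy0 (smul_nonneg hs hd0)⟩, rfl⟩
    simpa only [dotProduct_add, dotProduct_smul, hdb, smul_eq_mul] using this
  have h1 := hray 0 le_rfl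
  have h2 := hray ((val - B + 1) / (l j - u j)) (div_nonneg (by linarith) hlt'.le)
  rw [← neg_sub (l j : ℝ) (u j : ℝ), mul_neg, div_mul_cancel₀ _ hlt'.ne'] at h2
  linarith

/-- If the cone generated by rational vectors is box-integer, then its polar is box-TDI. -/
theorem isBoxTDI_of_isBoxInteger_ratCone (T : Finset (Fin n → ℚ))
    (hD : IsBoxInteger {x | x ∈ ratCone T}) :
    IsBoxTDI {x : Fin n → ℝ | ∀ a ∈ T, ratVec a ⬝ᵥ x ≤ 0} := by
  classical
  obtain ⟨H, hHT, hH⟩ := exists_hilbertBasis T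
  let e := H.equivFin.symm
  let A : Matrix (Fin H.card) (Fin n) ℚ := fun i j => ((e i).1 j : ℚ)
  have hA : ∀ i, ratVec (A i) = intVec (e i).1 := fun i => by
    ext j; simp [ratVec, intVec, A]
  have hAy : ∀ y : Fin H.card → ℝ, (realMat A)ᵀ *ᵥ y = ∑ i, y i • intVec (e i).1 := fun y => by
    ext j
    rw [Finset.sum_apply, Matrix.mulVec, dotProduct]
    refine Finset.sum_congr rfl fun i _ => ?_
    change ((A i j : ℚ) : ℝ) * y i = y i * _
    simp [A, intVec, mul_comm]
  have hcoeff : ∀ z : Fin n → ℤ, intVec z ∈ ratCone T →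
      ∃ c : Fin H.card → ℕ, (realMat A)ᵀ *ᵥ intVec (fun i => (c i : ℤ)) = intVec z := by
    intro z hz
    obtain ⟨c, hc⟩ := AddSubmonoid.mem_closure_finset'.1 (hH z hz)
    refine ⟨fun i => c (e i), ?_⟩
    have : intVec z = ∑ h : H, (c h : ℝ) • intVec h.1 := by
      rw [hc]; ext j; simp [intVec, Finset.sum_apply]
    rw [hAy, this, ← e.sum_comp]
    simp [intVec]
  have hpoly : {x : Fin n → ℝ | ∀ a ∈ T, ratVec a ⬝ᵥ x ≤ 0} = polyhedron A 0 := by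
    ext x
    constructor
    · intro hx i
      rw [realMat_mulVec_apply, hA, dotProduct_comm]
      simpa [ratVec] using dotProduct_nonpos_of_mem_ratCone (hHT _ (e i).2) hx
    · intro hx a ha
      obtain ⟨N, hN, z, hz⟩ := exists_intVec_eq_smul_ratVec a
      have hN' : (0 : ℝ) < N := by exact_mod_cast hN
      have hzT : intVec z ∈ ratCone T := by
        have := (ratCone T).smul_mem (N : ℝ≥0) (ratVec_mem_ratCone ha)
        rwa [NNReal.smul_def, NNReal.coe_natCast, ← hz] at this
      obtain ⟨c, hc⟩ := hcoeff z hzT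
      have h1 : intVec z ⬝ᵥ x ≤ 0 := by
        rw [← hc]
        refine (dotProduct_le_of_nonneg_combination (d := 0) hx fun i => ?_).trans_eq ?_
        · simp [intVec]
        · simp [ratVec, dotProduct]
      rw [hz, smul_dotProduct, smul_eq_mul] at h1
      exact nonpos_of_mul_nonpos_right h1 hN'
  refine ⟨H.card, A, 0, hpoly, fun l u w hne hbdd => ?_⟩
  have hlu := le_of_bddBelow_dual hne hbdd
  have hobj : ∀ y : Fin H.card ⊕ (Fin n ⊕ Fin n) → ℝ, ratVec (boxRhs 0 l u) ⬝ᵥ y =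
      ∑ j, (u j * y (.inr (.inl j)) - l j * y (.inr (.inr j))) := fun y => by
    rw [boxRhs_dotProduct]
    simp [ratVec, dotProduct]
  -- Hilbert basis coefficients of `z`, with the positive and negative parts of `w - z` as box
  -- multipliers.
  have hlift : ∀ z : Fin n → ℤ, intVec z ∈ ratCone T →
      ∃ y : Fin H.card ⊕ (Fin n ⊕ Fin n) → ℤ, intVec y ∈ dualFeasible (boxMatrix A) w ∧
        ratVec (boxRhs 0 l u) ⬝ᵥ intVec y = boxCost l u w (intVec z) := by
    intro z hz
    obtain ⟨c, hc⟩ := hcoeff z hz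
    refine ⟨Sum.elim (fun i => c i) (Sum.elim (fun j => (w j - z j)⁺) fun j => (w j - z j)⁻),
      ⟨?_, ?_⟩, ?_⟩
    · ext j
      rw [boxMatrix_transpose_mulVec]
      have h1 := congrFun hc j
      have h2 : ((w j - z j)⁺ : ℤ) - ((w j - z j)⁻ : ℤ) = (w j - z j : ℝ) := by
        exact_mod_cast posPart_sub_negPart (w j - z j)
      change ((realMat A)ᵀ *ᵥ intVec fun i => (c i : ℤ)) j + ((w j - z j)⁺ : ℤ) -
        ((w j - z j)⁻ : ℤ) = w j
      rw [h1, intVec]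
      linarith
    · rintro (i | j | j)
      · simp [intVec]
      · simp [intVec]
      · simp [intVec]
    · rw [hobj, boxCost_intVec_eq hlu]
      rfl
  obtain ⟨B, hB⟩ := hbdd
  obtain ⟨z, hz, hmin⟩ := exists_intVec_boxCost_min hD hlu w ⟨0, zero_mem (ratCone T)⟩
    ⟨B, fun z hz => by
      obtain ⟨y, hy, hyz⟩ := hlift z hz
      rw [← hyz]
      exact hB ⟨_, hy, rfl⟩⟩
  obtain ⟨y, hy, hyz⟩ := hlift z hz
  refine ⟨y, hy, fun y' hy' => ?_⟩
  rw [hyz, hobj]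
  -- Conversely, the row part of any dual solution gives a point of the cone, with cost at most the
  -- objective.
  refine (hmin ((realMat A)ᵀ *ᵥ fun i => y' (.inl i)) ?_).trans
    (boxCost_le hlu w _ (fun j => y' (.inr (.inl j))) (fun j => y' (.inr (.inr j)))
      (fun j => hy'.2 _) (fun j => hy'.2 _) fun j => ?_)
  · rw [Set.mem_ofPred_eq, hAy]
    refine sum_mem fun i _ => ?_
    have := (ratCone T).smul_mem (y' (.inl i)).toNNReal (hHT _ (e i).2)
    rwa [NNReal.smul_def, Real.coe_toNNReal _ (hy'.2 _)] at this
  · rw [← boxMatrix_transpose_mulVec, hy'.1]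
    rfl

end BoxTDICone

end BoxTDI

/-- For a cone `C = {x : A x ≤ 0}` of `ℝⁿ` with `A` rational, being box-TDI and being box-integer
are equivalent, and equivalent to the same properties of the polar cone. -/
theorem lemma4p3 (n m : ℕ) (A : Matrix (Fin m) (Fin n) ℚ) (C : Set (Fin n → ℝ))
    (hC : C = BoxTDI.polyhedron A 0) :
    List.TFAE
      [BoxTDI.IsBoxTDI C,
       BoxTDI.IsBoxInteger C,
       BoxTDI.IsBoxTDI (BoxTDI.polar C),
       BoxTDI.IsBoxInteger (BoxTDI.polar C)] := by
  classical
  let T : Finset (Fin n → ℚ) := Finset.univ.image fun i => A i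
  have hCT : C = {x | ∀ a ∈ T, BoxTDI.ratVec a ⬝ᵥ x ≤ 0} := by
    ext x
    simp only [hC, T, Finset.forall_mem_image, Finset.mem_univ, true_imp_iff, Set.mem_ofPred_eq,
      BoxTDI.polyhedron, Pi.le_def, BoxTDI.realMat_mulVec_apply]
    simp [BoxTDI.ratVec]
  obtain ⟨G, hG⟩ := BoxTDI.exists_ratCone_eq T
  have hCG : C = {x | x ∈ BoxTDI.ratCone G} := by
    rw [hCT]; ext x; exact (hG x).symm
  have hpolarT : BoxTDI.polar C = {x | x ∈ BoxTDI.ratCone T} := by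
    rw [hCT]; ext x; exact BoxTDI.mem_ratCone_iff_forall.symm
  have hpolarG : BoxTDI.polar C = {x | ∀ a ∈ G, BoxTDI.ratVec a ⬝ᵥ x ≤ 0} := by
    rw [hCG]
    ext x
    constructor
    · intro hx a ha
      exact hx _ (BoxTDI.ratVec_mem_ratCone ha)
    · intro hx z hz
      rw [dotProduct_comm]
      exact BoxTDI.dotProduct_nonpos_of_mem_ratCone hz hx
  have hsmul : ∀ S : Finset (Fin n → ℚ), ∀ x ∈ {x | ∀ a ∈ S, BoxTDI.ratVec a ⬝ᵥ x ≤ 0},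
      ∀ t : ℝ, 0 ≤ t → t • x ∈ {x | ∀ a ∈ S, BoxTDI.ratVec a ⬝ᵥ x ≤ 0} := by
    intro S x hx t ht a ha
    rw [dotProduct_smul, smul_eq_mul]
    exact mul_nonpos_of_nonneg_of_nonpos ht (hx a ha)
  tfae_have 1 → 2 := BoxTDI.IsBoxTDI.isBoxInteger (hCT ▸ hsmul T)
  tfae_have 2 → 3 := fun h => hpolarG ▸ BoxTDI.isBoxTDI_of_isBoxInteger_ratCone G (hCG ▸ h)
  tfae_have 3 → 4 := BoxTDI.IsBoxTDI.isBoxInteger (hpolarG ▸ hsmul G)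
  tfae_have 4 → 1 := fun h => hCT ▸ BoxTDI.isBoxTDI_of_isBoxInteger_ratCone T (hpolarT ▸ h)
  tfae_finish
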